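/- Let $\mathbb M=\mathbb R^2$ be the Minkowski plane, with coordinates $(x,t)$ and pseudo-distance $\delta\big((x_1,t_1),(x_2,t_2)\big)=\sqrt{(x_2-x_1)^2-(t_2-t_1)^2}\in\mathbb R_{\ge 0}\cup i\,\mathbb R_{\ge 0}$. An algebraic subset of $\mathbb R^N$ is the zero set $f^{-1}(0)$ of a polynomial map $f:\mathbb R^N\to\mathbb R^m$; a semi-algebraic subset of $\mathbb R^N$ is the image of an algebraic subset of some $\mathbb R^N\times\mathbb R^k$ under the projection to $\mathbb R^N$. (Semi-)algebraic subsets of $\mathbb M^n$ are those of $\mathbb R^{2n}\cong\mathbb M^n$. A linkage $\mathcal L$ in $\mathbb M$ is a finite connected graph $(V,E)$ with a length function $l:E\to\mathbb R_{\ge0}\cup i\,\mathbb R_{\ge0}$, a nonempty set $F\subseteq V$ of fixed vertices and a map $\phi_0:F\to\mathbb M$. A realization of $\mathcal L$ is a map $\phi:V\to\mathbb M$ with $\phi|_F=\phi_0$ and $\delta(\phi(v),\phi(w))=l(vw)$ for every edge $vw\in E$. The configuration space $\mathrm{Conf}_{\mathbb M}(\mathcal L)\subseteq\mathbb M^V$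 is the set of all realizations, and for $W\subseteq V$ the partial configuration space is $\mathrm{Conf}^W_{\mathbb M}(\mathcal L)=\{\phi|_W : \phi\in \mathrm{Conf}_{\mathbb M}(\mathcal L)\}\subseteq\mathbb M^W$. Theorem. Let $n\in\mathbb N$ and let $A$ be a semi-algebraic subset of $\mathbb M^n\cong\mathbb R^{2n}$ (not necessarily compact). Then there are a linkage $\mathcal L$ in $\mathbb M$ and a set $W$ of $n$ vertices of $\mathcal L$ such that $\mathrm{Conf}^W_{\mathbb M}(\mathcal L)=A$, where $\mathbb M^W$ is identified with $\mathbb M^n$ by a suitable numbering of $W$. If moreover $A$ is algebraic, then $\mathcal L$ and $W$ can be chosen such that, in addition, the restriction map $\mathrm{Conf}_{\mathbb M}(\mathcal L)\to A$, $\phi\mapsto\phi|_W$, is a smooth finite trivial covering: for some integer $k\ge1$ there is a homeomorphism $\Phi:\mathrm{Conf}_{\mathbb M}(\mathcal L)\to A\times\{1,\dots,k\}$ (with $\{1,\dots,k\}$ discrete) whose first component is the restriction map, and such that $a\mapsto\Phi^{-1}(a,j)$ is smooth on $A$ for every $j$. Here a map on a subset of $\mathbb R^p$ is called smooth if it is the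 restriction of a $C^\infty$ map defined on all of $\mathbb R^p$. -/

import Mathlib

open scoped ContDiff

noncomputable section

/-! ### Algebraic and semi-algebraic sets -/

/-- Algebraic subsets of `ℝ^ι`: zero sets of finitely many real polynomials, that is
`f ⁻¹' {0}` for a polynomial map `f : ℝ^ι → ℝ^m`. -/
def IsAlgebraicSet {ι : Type} (A : Set (ι → ℝ)) : Prop :=
  ∃ (m : ℕ) (f : Fin m → MvPolynomial ι ℝ), A = {x | ∀ j, MvPolynomial.eval x (f j) = 0}

/-- Semi-algebraic subsets of `ℝ^ι`: images of algebraic subsets of `ℝ^ι × ℝ^k` under the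
projection onto `ℝ^ι`, for some `k`. -/
def IsSemialgebraicSet {ι : Type} (B : Set (ι → ℝ)) : Prop :=
  ∃ (k : ℕ) (A : Set (ι ⊕ Fin k → ℝ)), IsAlgebraicSet A ∧
    B = (fun (x : ι ⊕ Fin k → ℝ) (i : ι) => x (Sum.inl i)) '' A

/-! ### The Minkowski plane -/

/-- The underlying plane `ℝ²`; the first coordinate is the space coordinate `x`, the second one
the time coordinate `t`. -/
abbrev MinkowskiPlane : Type := ℝ × ℝ

/-- The set `ℝ≥0 ∪ i ℝ≥0` of possible lengths. -/
def pseudoLengths : Set ℂ :=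
  {c | ∃ r : ℝ, 0 ≤ r ∧ (c = (r : ℂ) ∨ c = (r : ℂ) * Complex.I)}

/-- The squared interval `(x₂ - x₁)² - (t₂ - t₁)²`. -/
def minkowskiSq (α β : MinkowskiPlane) : ℝ :=
  (β.1 - α.1) ^ 2 - (β.2 - α.2) ^ 2

/-- The pseudo-distance `δ(α, β) = √((x₂ - x₁)² - (t₂ - t₁)²) ∈ ℝ≥0 ∪ i ℝ≥0`. -/
def minkowskiDist (α β : MinkowskiPlane) : ℂ :=
  if 0 ≤ minkowskiSq α β then (Real.sqrt (minkowskiSq α β) : ℂ)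
  else (Real.sqrt (-minkowskiSq α β) : ℂ) * Complex.I

/-- The identification of `𝕄ⁿ` with `ℝ²ⁿ`; the `2n` real coordinates are indexed by
`Fin n × Fin 2`. -/
def minkowskiCoords (n : ℕ) : (Fin n → MinkowskiPlane) ≃ (Fin n × Fin 2 → ℝ) where
  toFun p := fun ij => if ij.2 = 0 then (p ij.1).1 else (p ij.1).2
  invFun x := fun i => (x (i, 0), x (i, 1))
  left_inv p := by ext i <;> simp
  right_inv x := by
    funext ⟨i, j⟩
    fin_cases j <;> simp

/-- (Semi-)algebraic subsets of `𝕄ⁿ` are those of `ℝ²ⁿ`. -/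
def IsAlgebraicSubset {n : ℕ} (A : Set (Fin n → MinkowskiPlane)) : Prop :=
  IsAlgebraicSet (minkowskiCoords n '' A)

def IsSemialgebraicSubset {n : ℕ} (A : Set (Fin n → MinkowskiPlane)) : Prop :=
  IsSemialgebraicSet (minkowskiCoords n '' A)

/-! ### Linkages -/

/-- A linkage in the Minkowski plane with vertex set `V`. -/
structure Linkage (V : Type) where
  /-- the underlying graph -/
  graph : SimpleGraph V
  /-- the length of each edge -/
  length : graph.edgeSet → pseudoLengths
  /-- the fixed vertices -/
  fixed : Set V
  /-- the places where the fixed vertices are pinned down -/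
  pos : fixed → MinkowskiPlane

namespace Linkage

variable {V : Type}

/-- Realizations of a linkage. -/
def IsRealization (L : Linkage V) (φ : V → MinkowskiPlane) : Prop :=
  (∀ (v w : V) (h : L.graph.Adj v w),
      minkowskiDist (φ v) (φ w) = (L.length ⟨s(v, w), h⟩ : ℂ)) ∧
    ∀ a : L.fixed, φ a = L.pos a

/-- The configuration space: the set of all realizations. -/
def conf (L : Linkage V) : Set (V → MinkowskiPlane) :=
  {φ | L.IsRealization φ}

/-- The partial configuration space with respect to a set `W` of vertices: the set of the
restrictions to `W` of all realizations. -/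
def partialConf (L : Linkage V) (W : Set V) : Set (W → MinkowskiPlane) :=
  W.domRestrict '' L.conf

end Linkage

/-- The identification of `𝕄^W` with `𝕄ⁿ` given by a numbering of the elements of `W`. -/
def relabel {V : Type} {W : Set V} {n : ℕ} (e : Fin n ≃ W) (ψ : W → MinkowskiPlane) :
    Fin n → MinkowskiPlane :=
  fun i => ψ (e i)

/-! ### Smooth finite trivial coverings -/

/-- A map is smooth on an arbitrary subset `S` of a normed space if on `S` it agrees with a
smooth map defined on the whole space. -/
def IsSmoothOnSubset {E F : Type} [NormedAddCommGroup E] [NormedSpace ℝ E]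
    [NormedAddCommGroup F] [NormedSpace ℝ F] (f : E → F) (S : Set E) : Prop :=
  ∃ g : E → F, ContDiff ℝ ∞ g ∧ Set.EqOn f g S

/-- `ρ` restricts to a smooth finite trivial covering `S → A`: there are a finite nonempty
discrete fibre `{0, …, k - 1}` and a diffeomorphism `S ≅ A × {0, …, k - 1}` over `A`.
The diffeomorphism is a homeomorphism `Φ` whose first component is `ρ`, smooth on `S`, whose
second component has values in a discrete space, and whose inverse is smooth on each sheet
`A × {j}`. -/
def IsSmoothFiniteTrivialCovering {E F : Type} [NormedAddCommGroup E] [NormedSpace ℝ E]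
    [NormedAddCommGroup F] [NormedSpace ℝ F] (ρ : E → F) (S : Set E) (A : Set F) : Prop :=
  IsSmoothOnSubset ρ S ∧
    ∃ (k : ℕ) (_ : 0 < k) (Φ : S ≃ₜ A × Fin k),
      (∀ x : S, ((Φ x).1 : F) = ρ x) ∧
      ∀ j : Fin k, ∃ σ : F → E, IsSmoothOnSubset σ A ∧
        ∀ a : A, σ a = (Φ.symm (a, j) : E)

end

/-!
In the null coordinates `u = x - t` and `v = x + t`, the squared pseudo-distance of two points is
`(u - u') * (v - v')`, so a bar imposes a value on this product. Bars of length zero that end at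
fixed points confine a vertex to null lines, and this is enough to give a vertex the first null
coordinate of one vertex and the second null coordinate of another one. A linkage can therefore
impose any finite set of equations `(u i - u j) * (v k - v l) = c` on the null coordinates of
finitely many points, where also `0` and `1` may be used as entries
(`ProductEq.mem_conf_linkage`).

These equations connect first null coordinates only with second ones. For any real number `a`, the
equations `ProductEq.transfer` force both null coordinates of a point to be `a`. They use a root `w`
of `w * (w - a) = 1` and `p = w + w⁻¹`. As `p ^ 2 = a ^ 2 + 4`, the number `p` avoids the interval
`(-2, 2)`. A chain of three homographies with poles at `0`, `1` and `∞` copies `p` from the first to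
the second null coordinate, and from `p` one gets the same for `w` and `a`. The two roots are
distinct and smooth in `a`, so this costs a two-sheeted trivial covering, and from then on real
unknowns `x` subject to equations `(x i - x j) * (x k - x l) = c` are available
(`ProductEq.diagonal_iff`).

A `SheetedSystem` is a system of such equations whose solutions form a finite trivial covering of a
space of parameters. The same roots `w`, which never vanish, allow one to extend a system by the
unknowns `g + a * h` and `g ^ 2` for all real values of the known functions `g` and `h`
(`SheetedSystem.exists_knows_add_const_mul`, `SheetedSystem.exists_knows_sq`). So there are systems
that compute all the polynomials that define an algebraic set, and the equations saying that the
values of these polynomials are zero cut the covering down to this set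
(`exists_linkage_of_isAlgebraicSet`). The semi-algebraic case follows by not marking the variables
that are projected away.
-/

/-! ### Null coordinates -/

/-- The pseudo-length whose square is the given real number. -/
noncomputable def lengthOfSq (c : ℝ) : ℂ :=
  if 0 ≤ c then (Real.sqrt c : ℂ) else (Real.sqrt (-c) : ℂ) * Complex.I

theorem lengthOfSq_mem (c : ℝ) : lengthOfSq c ∈ pseudoLengths := by
  unfold lengthOfSq
  split_ifs
  · exact ⟨_, Real.sqrt_nonneg _, Or.inl rfl⟩
  · exact ⟨_, Real.sqrt_nonneg _, Or.inr rfl⟩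

theorem lengthOfSq_sq (c : ℝ) : lengthOfSq c ^ 2 = c := by
  unfold lengthOfSq
  split_ifs with h
  · rw [← Complex.ofReal_pow, Real.sq_sqrt h]
  · rw [mul_pow, Complex.I_sq, ← Complex.ofReal_pow, Real.sq_sqrt (by linarith)]
    push_cast
    ring

theorem lengthOfSq_injective : Function.Injective lengthOfSq := fun a b h => by
  have := congrArg (· ^ 2) h
  simpa only [lengthOfSq_sq, Complex.ofReal_inj] using this

theorem minkowskiDist_eq_lengthOfSq_iff (α β : MinkowskiPlane) (c : ℝ) :
    minkowskiDist α β = lengthOfSq c ↔ minkowskiSq α β = c :=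
  lengthOfSq_injective.eq_iff (a := minkowskiSq α β)

/-- The point with null coordinates `x - t = u` and `x + t = v`. -/
noncomputable def nullPoint (u v : ℝ) : MinkowskiPlane := ((u + v) / 2, (v - u) / 2)

theorem minkowskiSq_nullPoint (a b c d : ℝ) :
    minkowskiSq (nullPoint a b) (nullPoint c d) = (a - c) * (b - d) := by
  simp only [minkowskiSq, nullPoint]
  ring

theorem exists_eq_nullPoint (α : MinkowskiPlane) : ∃ u v, α = nullPoint u v :=
  ⟨α.1 - α.2, α.1 + α.2, by ext <;> simp only [nullPoint] <;> ring⟩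

theorem nullPoint_inj {a b c d : ℝ} : nullPoint a b = nullPoint c d ↔ a = c ∧ b = d := by
  simp only [nullPoint, Prod.mk.injEq]
  constructor
  · rintro ⟨h₁, h₂⟩
    constructor <;> linarith
  · rintro ⟨rfl, rfl⟩
    exact ⟨rfl, rfl⟩

/-! ### Product equations -/

/-- The real number `0` or `1`. -/
def bit (b : Bool) : ℝ := if b then 1 else 0

@[simp] theorem bit_false : bit false = 0 := rfl

@[simp] theorem bit_true : bit true = 1 := rfl

/-- An entry of an equation: a variable, or one of the constants `0` and `1`. -/
inductive Entry (I : Type) : Type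
  | var (i : I)
  | const (b : Bool)

/-- The value of an entry for given values of the variables. -/
def Entry.eval {I : Type} (x : I → ℝ) : Entry I → ℝ
  | var i => x i
  | const b => bit b

@[simp] theorem Entry.eval_var {I : Type} (x : I → ℝ) (i : I) : (Entry.var i).eval x = x i := rfl

@[simp] theorem Entry.eval_const {I : Type} (x : I → ℝ) (b : Bool) :
    (Entry.const b).eval x = bit b := rfl

def Entry.map {I J : Type} (f : I → J) : Entry I → Entry J
  | var i => var (f i)
  | const b => const b

@[simp] theorem Entry.eval_map {I J : Type} (f : I → J) (x : J → ℝ) (p : Entry I) :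
    (p.map f).eval x = p.eval (x ∘ f) := by
  cases p <;> rfl

/-- The equation `(p - q) * (r - s) = c`. The entries `p`, `q` of the first factor and the entries
`r`, `s` of the second factor are evaluated at two separate families of values, the first and the
second null coordinates. -/
structure ProductEq (I : Type) where
  (p q r s : Entry I)
  (c : ℝ)

/-- The equation holds for the values `u` in the first factor and `v` in the second factor. -/
def ProductEq.Holds {I : Type} (κ : ProductEq I) (u v : I → ℝ) : Prop :=
  (κ.p.eval u - κ.q.eval u) * (κ.r.eval v - κ.s.eval v) = κ.c

def ProductEq.map {I J : Type} (f : I → J) (κ : ProductEq I) : ProductEq J :=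
  ⟨κ.p.map f, κ.q.map f, κ.r.map f, κ.s.map f, κ.c⟩

@[simp] theorem ProductEq.holds_map {I J : Type} (f : I → J) (κ : ProductEq I) (u v : J → ℝ) :
    (κ.map f).Holds u v ↔ κ.Holds (u ∘ f) (v ∘ f) := by
  simp [ProductEq.Holds, ProductEq.map]

/-! ### The linkage of a family of product equations -/

/-- The vertices of the linkage of a family of product equations in the variables `I`, with further
points labelled by `X`. In null coordinates, `corner a b` is pinned at `(a, b)`, the vertices
`trackU b i` and `trackV b i` are at `(u i, b)` and `(b, v i)`, and `point x` is at a place whose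
two null coordinates are entries. -/
inductive Vertex (I X : Type) : Type
  | corner (a b : Bool)
  | trackU (b : Bool) (i : I)
  | trackV (b : Bool) (i : I)
  | point (x : X)

namespace Vertex

variable {I X : Type}

instance [Finite I] [Finite X] : Finite (Vertex I X) :=
  Finite.of_injective
    (β := (Bool × Bool) ⊕ (Bool × I) ⊕ (Bool × I) ⊕ X)
    (fun
      | corner a b => Sum.inl (a, b)
      | trackU b i => Sum.inr (Sum.inl (b, i))
      | trackV b i => Sum.inr (Sum.inr (Sum.inl (b, i)))
      | point x => Sum.inr (Sum.inr (Sum.inr x)))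
    (by rintro (_ | _ | _ | _) (_ | _ | _ | _) h <;> simp_all)

/-- The vertex whose null coordinates are an entry and the constant `b`. -/
def ofEntryU (b : Bool) : Entry I → Vertex I X
  | .var i => trackU b i
  | .const a => corner a b

/-- The vertex whose null coordinates are the constant `b` and an entry. -/
def ofEntryV (b : Bool) : Entry I → Vertex I X
  | .var i => trackV b i
  | .const a => corner b a

/-- The bars of length zero, each in one of its two orientations. -/
inductive Zero (h : X → Entry I × Entry I) : Vertex I X → Vertex I X → Prop
  | corner_u (b : Bool) : Zero h (corner false b) (corner true b)
  | corner_v (a : Bool) : Zero h (corner a false) (corner a true)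
  | trackU_corner (a b : Bool) (i : I) : Zero h (trackU b i) (corner a b)
  | trackU (i : I) : Zero h (trackU false i) (trackU true i)
  | trackV_corner (a b : Bool) (i : I) : Zero h (trackV b i) (corner b a)
  | trackV (i : I) : Zero h (trackV false i) (trackV true i)
  | point_u (b : Bool) (x : X) : Zero h (point x) (ofEntryU b (h x).1)
  | point_v (b : Bool) (x : X) : Zero h (point x) (ofEntryV b (h x).2)

/-- The positions of the vertices for given values of the variables. -/
noncomputable def place (h : X → Entry I × Entry I) (u v : I → ℝ) : Vertex I X → MinkowskiPlane
  | corner a b => nullPoint (bit a) (bit b)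
  | trackU b i => nullPoint (u i) (bit b)
  | trackV b i => nullPoint (bit b) (v i)
  | point x => nullPoint ((h x).1.eval u) ((h x).2.eval v)

theorem place_ofEntryU (h : X → Entry I × Entry I) (u v : I → ℝ) (b : Bool) (p : Entry I) :
    place h u v (ofEntryU b p) = nullPoint (p.eval u) (bit b) := by
  cases p <;> rfl

theorem place_ofEntryV (h : X → Entry I × Entry I) (u v : I → ℝ) (b : Bool) (p : Entry I) :
    place h u v (ofEntryV b p) = nullPoint (bit b) (p.eval v) := by
  cases p <;> rfl

theorem Zero.ne {h : X → Entry I × Entry I} {a b : Vertex I X} (hz : Zero h a b) : a ≠ b := by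
  cases hz with
  | point_u b x => generalize (h x).1 = p; cases p <;> simp [ofEntryU]
  | point_v b x => generalize (h x).2 = p; cases p <;> simp [ofEntryV]
  | _ => simp

theorem not_zero_point {h : X → Entry I × Entry I} {x y : X} : ¬ Zero h (point x) (point y) := by
  intro hz
  generalize hb : (point y : Vertex I X) = b at hz
  cases hz with
  | point_u b x => generalize (h x).1 = p at hb; cases p <;> simp [ofEntryU] at hb
  | point_v b x => generalize (h x).2 = p at hb; cases p <;> simp [ofEntryV] at hb

theorem minkowskiSq_place_of_zero {h : X → Entry I × Entry I} (u v : I → ℝ) {a b : Vertex I X}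
    (hz : Zero h a b) : minkowskiSq (place h u v a) (place h u v b) = 0 := by
  cases hz with
  | point_u b x => rw [place_ofEntryU, place, minkowskiSq_nullPoint, sub_self, zero_mul]
  | point_v b x => rw [place_ofEntryV, place, minkowskiSq_nullPoint, sub_self, mul_zero]
  | _ => simp [place, minkowskiSq_nullPoint]

/-- Bars of length zero force every vertex to its place, once the corners are pinned: a point at
light-like separation from two distinct points of a null line lies on this line. -/
theorem exists_eq_place {h : X → Entry I × Entry I} {φ : Vertex I X → MinkowskiPlane}
    (hφ : ∀ a b, Zero h a b → minkowskiSq (φ a) (φ b) = 0)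
    (hc : ∀ a b, φ (corner a b) = nullPoint (bit a) (bit b)) :
    ∃ u v, φ = place h u v := by
  choose U V hUV using fun a => exists_eq_nullPoint (φ a)
  have hz : ∀ a b, Zero h a b → (U a - U b) * (V a - V b) = 0 := fun a b hab => by
    rw [← minkowskiSq_nullPoint, ← hUV, ← hUV, hφ a b hab]
  have hcU : ∀ a b, U (corner a b) = bit a := fun a b =>
    (nullPoint_inj.1 ((hUV _).symm.trans (hc a b))).1
  have hcV : ∀ a b, V (corner a b) = bit b := fun a b =>
    (nullPoint_inj.1 ((hUV _).symm.trans (hc a b))).2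
  have hUV1 : ∀ b i, V (trackU b i) = bit b := fun b i => by
    have h₀ := hz _ _ (Zero.trackU_corner false b i)
    have h₁ := hz _ _ (Zero.trackU_corner true b i)
    simp only [hcU, hcV, bit_false, bit_true] at h₀ h₁
    linear_combination h₀ - h₁
  have hVU1 : ∀ b i, U (trackV b i) = bit b := fun b i => by
    have h₀ := hz _ _ (Zero.trackV_corner false b i)
    have h₁ := hz _ _ (Zero.trackV_corner true b i)
    simp only [hcU, hcV, bit_false, bit_true] at h₀ h₁
    linear_combination h₀ - h₁
  have hUU : ∀ b i, U (trackU b i) = U (trackU false i) := fun b i => by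
    have h₀ := hz _ _ (Zero.trackU i)
    simp only [hUV1, bit_false, bit_true] at h₀
    cases b
    · rfl
    · linear_combination h₀
  have hVV : ∀ b i, V (trackV b i) = V (trackV false i) := fun b i => by
    have h₀ := hz _ _ (Zero.trackV i)
    simp only [hVU1, bit_false, bit_true] at h₀
    cases b
    · rfl
    · linear_combination h₀
  have hEU : ∀ b (p : Entry I), U (ofEntryU b p) = p.eval (fun i => U (trackU false i)) ∧
      V (ofEntryU b p) = bit b := by
    rintro b (i | a)
    · exact ⟨hUU b i, hUV1 b i⟩
    · exact ⟨hcU a b, hcV a b⟩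
  have hEV : ∀ b (p : Entry I), U (ofEntryV b p) = bit b ∧
      V (ofEntryV b p) = p.eval (fun i => V (trackV false i)) := by
    rintro b (i | a)
    · exact ⟨hVU1 b i, hVV b i⟩
    · exact ⟨hcU b a, hcV b a⟩
  refine ⟨fun i => U (trackU false i), fun i => V (trackV false i), funext fun a => ?_⟩
  rw [hUV]
  cases a with
  | corner a b => rw [hcU, hcV]; rfl
  | trackU b i => rw [hUU, hUV1]; rfl
  | trackV b i => rw [hVV, hVU1]; rfl
  | point x =>
    have h₁ := hz _ _ (Zero.point_u false x)
    have h₂ := hz _ _ (Zero.point_u true x)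
    have h₃ := hz _ _ (Zero.point_v false x)
    have h₄ := hz _ _ (Zero.point_v true x)
    simp only [(hEU _ _).1, (hEU _ _).2, (hEV _ _).1, (hEV _ _).2, bit_false, bit_true]
      at h₁ h₂ h₃ h₄
    refine nullPoint_inj.2 ⟨?_, ?_⟩
    · linear_combination h₁ - h₂
    · linear_combination h₃ - h₄

theorem place_injective (h : X → Entry I × Entry I) {u v u' v' : I → ℝ}
    (heq : place h u v = place h u' v') : u = u' ∧ v = v' := by
  constructor
  · funext i
    exact (nullPoint_inj.1 (congrFun heq (trackU false i))).1
  · funext i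
    exact (nullPoint_inj.1 (congrFun heq (trackV false i))).2

theorem contDiff_place [Fintype (Vertex I X)] {E : Type} [NormedAddCommGroup E]
    [NormedSpace ℝ E] (h : X → Entry I × Entry I) {u v : E → I → ℝ}
    (hu : ∀ i, ContDiff ℝ ∞ fun e => u e i) (hv : ∀ i, ContDiff ℝ ∞ fun e => v e i) :
    ContDiff ℝ ∞ fun e => place h (u e) (v e) := by
  have hn : ∀ {f g : E → ℝ}, ContDiff ℝ ∞ f → ContDiff ℝ ∞ g →
      ContDiff ℝ ∞ fun e => nullPoint (f e) (g e) := fun hf hg => by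
    unfold nullPoint
    fun_prop
  have hE : ∀ {x : E → I → ℝ}, (∀ i, ContDiff ℝ ∞ fun e => x e i) → ∀ p : Entry I,
      ContDiff ℝ ∞ fun e => p.eval (x e) := by
    rintro x hx (i | b)
    · exact hx i
    · exact contDiff_const
  refine contDiff_pi.2 fun a => ?_
  cases a with
  | corner a b => exact contDiff_const
  | trackU b i => exact hn (hu i) contDiff_const
  | trackV b i => exact hn contDiff_const (hv i)
  | point x => exact hn (hE hu _) (hE hv _)

end Vertex

namespace ProductEq

variable {I K : Type} {n : ℕ}

/-- The points of the linkage of a family of product equations: the equation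
`(p - q) * (r - s) = c` has the two points `(p, r)` and `(q, s)`, and `n` further points are marked,
their null coordinates being entries. -/
def points (κ : K → ProductEq I) (m : Fin n → Entry I × Entry I) :
    (K × Bool) ⊕ Fin n → Entry I × Entry I
  | Sum.inl (k, false) => ((κ k).p, (κ k).r)
  | Sum.inl (k, true) => ((κ k).q, (κ k).s)
  | Sum.inr j => m j

/-- The bar that expresses an equation. -/
def bar (I : Type) (n : ℕ) (k : K) : Sym2 (Vertex I ((K × Bool) ⊕ Fin n)) :=
  s(.point (Sum.inl (k, false)), .point (Sum.inl (k, true)))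

theorem bar_injective : Function.Injective (bar (K := K) I n) := by
  intro k k' h
  simpa [bar] using h

open Classical in
/-- The squared lengths of the bars: the constant of the equation for the bar of an equation, and
zero for all the other bars. -/
noncomputable def barSq (n : ℕ) (κ : K → ProductEq I)
    (e : Sym2 (Vertex I ((K × Bool) ⊕ Fin n))) : ℝ :=
  if h : ∃ k, e = bar I n k then (κ h.choose).c else 0

theorem barSq_bar (κ : K → ProductEq I) (k : K) : barSq n κ (bar I n k) = (κ k).c := by
  have h : ∃ k', bar I n k = bar I n k' := ⟨k, rfl⟩
  rw [barSq, dif_pos h, ← bar_injective h.choose_spec]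

/-- The graph of the linkage of a family of product equations. -/
def barGraph (κ : K → ProductEq I) (m : Fin n → Entry I × Entry I) :
    SimpleGraph (Vertex I ((K × Bool) ⊕ Fin n)) where
  Adj a b := Vertex.Zero (points κ m) a b ∨ Vertex.Zero (points κ m) b a ∨ ∃ k, s(a, b) = bar I n k
  symm := ⟨fun a b h => by rw [Sym2.eq_swap]; tauto⟩
  loopless := ⟨by
    rintro a (h | h | ⟨k, h⟩)
    · exact h.ne rfl
    · exact h.ne rfl
    · simp only [bar, Sym2.eq_iff] at h
      rcases h with ⟨h, h'⟩ | ⟨h, h'⟩ <;> simp [h] at h'⟩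

/-- The linkage of a family of product equations. -/
noncomputable def linkage (κ : K → ProductEq I) (m : Fin n → Entry I × Entry I) :
    Linkage (Vertex I ((K × Bool) ⊕ Fin n)) where
  graph := barGraph κ m
  length e := ⟨lengthOfSq (barSq n κ e), lengthOfSq_mem _⟩
  fixed := Set.range fun ab : Bool × Bool => Vertex.corner ab.1 ab.2
  -- The place of a corner does not depend on the values of the variables.
  pos a := Vertex.place (points κ m) 0 0 a

theorem barSq_of_zero {κ : K → ProductEq I} {m : Fin n → Entry I × Entry I}
    {a b : Vertex I ((K × Bool) ⊕ Fin n)} (hz : Vertex.Zero (points κ m) a b) :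
    barSq n κ s(a, b) = 0 := by
  refine dif_neg ?_
  rintro ⟨k, h⟩
  simp only [bar, Sym2.eq_iff] at h
  rcases h with ⟨rfl, rfl⟩ | ⟨rfl, rfl⟩ <;> exact Vertex.not_zero_point hz

/-- The realizations of the linkage are the solutions of the equations. -/
theorem mem_conf_linkage (κ : K → ProductEq I) (m : Fin n → Entry I × Entry I)
    (φ : Vertex I ((K × Bool) ⊕ Fin n) → MinkowskiPlane) :
    φ ∈ (linkage κ m).conf ↔
      ∃ u v, (∀ k, (κ k).Holds u v) ∧ φ = Vertex.place (points κ m) u v := by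
  have hsymm : ∀ α β, minkowskiSq α β = minkowskiSq β α := fun α β => by
    simp only [minkowskiSq]; ring
  constructor
  · rintro ⟨hφ, hfix⟩
    have hsq : ∀ a b, (linkage κ m).graph.Adj a b →
        minkowskiSq (φ a) (φ b) = barSq n κ s(a, b) := fun a b h =>
      (minkowskiDist_eq_lengthOfSq_iff _ _ _).1 (hφ a b h)
    obtain ⟨u, v, rfl⟩ := Vertex.exists_eq_place (h := points κ m) (φ := φ)
      (fun a b hz => (hsq a b (Or.inl hz)).trans (barSq_of_zero hz))
      (fun a b => hfix ⟨_, (a, b), rfl⟩)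
    refine ⟨u, v, fun k => ?_, rfl⟩
    have := hsq _ _ (Or.inr (Or.inr ⟨k, rfl⟩))
    rwa [show s(_, _) = bar I n k from rfl, barSq_bar, Vertex.place, Vertex.place,
      minkowskiSq_nullPoint] at this
  · rintro ⟨u, v, hk, rfl⟩
    refine ⟨fun a b h => (minkowskiDist_eq_lengthOfSq_iff _ _ _).2 ?_, ?_⟩
    · change _ = barSq n κ s(a, b)
      rcases h with h | h | ⟨k, h⟩
      · rw [Vertex.minkowskiSq_place_of_zero u v h, barSq_of_zero h]
      · rw [hsymm, Vertex.minkowskiSq_place_of_zero u v h, Sym2.eq_swap, barSq_of_zero h]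
      · rw [h, barSq_bar]
        have hbar : minkowskiSq (Vertex.place (points κ m) u v (.point (Sum.inl (k, false))))
            (Vertex.place (points κ m) u v (.point (Sum.inl (k, true)))) = (κ k).c := by
          rw [Vertex.place, Vertex.place, minkowskiSq_nullPoint]
          exact hk k
        simp only [bar, Sym2.eq_iff] at h
        rcases h with ⟨rfl, rfl⟩ | ⟨rfl, rfl⟩
        · exact hbar
        · rw [hsymm, hbar]
    · rintro ⟨_, ⟨a, b⟩, rfl⟩
      rfl

theorem connected_linkage (κ : K → ProductEq I) (m : Fin n → Entry I × Entry I) :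
    (linkage κ m).graph.Connected := by
  have adj : ∀ {a b}, Vertex.Zero (points κ m) a b → (linkage κ m).graph.Reachable a b :=
    fun h => SimpleGraph.Adj.reachable (G := (linkage κ m).graph) (Or.inl h)
  have hc : ∀ a b, (linkage κ m).graph.Reachable (.corner a b) (.corner false false) := by
    have h₁ := adj (.corner_u false)
    have h₂ := adj (.corner_v false)
    have h₃ := adj (.corner_v true)
    rintro (_ | _) (_ | _)
    · rfl
    · exact h₂.symm
    · exact h₁.symm
    · exact h₃.symm.trans h₁.symm
  have hU : ∀ b i, (linkage κ m).graph.Reachable (.trackU b i) (.corner false false) :=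
    fun b i => (adj (.trackU_corner false b i)).trans (hc _ _)
  have h₀ : ∀ a, (linkage κ m).graph.Reachable a (.corner false false) := by
    rintro (⟨a, b⟩ | ⟨b, i⟩ | ⟨b, i⟩ | x)
    · exact hc a b
    · exact hU b i
    · exact (adj (.trackV_corner false b i)).trans (hc _ _)
    · refine (adj (.point_u false x)).trans ?_
      generalize (points κ m x).1 = p
      cases p with
      | var i => exact hU false i
      | const a => exact hc a false
  exact { preconnected := fun a b => (h₀ a).trans (h₀ b).symm, nonempty := ⟨.corner false false⟩ }

theorem fixed_linkage_nonempty (κ : K → ProductEq I) (m : Fin n → Entry I × Entry I) :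
    (linkage κ m).fixed.Nonempty :=
  ⟨_, (false, false), rfl⟩

end ProductEq

/-! ### A quadratic equation with two simple roots -/

/-- The two roots `w` of `w * (w - y) = 1`. -/
noncomputable def unitRoot (b : Bool) (y : ℝ) : ℝ :=
  (y + (if b then 1 else -1) * Real.sqrt (y ^ 2 + 4)) / 2

theorem unitRoot_mul_sub (b : Bool) (y : ℝ) : unitRoot b y * (unitRoot b y - y) = 1 := by
  have h : Real.sqrt (y ^ 2 + 4) ^ 2 = y ^ 2 + 4 := Real.sq_sqrt (by positivity)
  cases b <;> simp only [unitRoot, if_true, Bool.false_eq_true, if_false] <;>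
    linear_combination h / 4

theorem unitRoot_ne_zero (b : Bool) (y : ℝ) : unitRoot b y ≠ 0 := fun h => by
  simpa [h] using unitRoot_mul_sub b y

theorem mul_sub_eq_one_iff (w y : ℝ) : w * (w - y) = 1 ↔ ∃ b, w = unitRoot b y := by
  constructor
  · intro h
    have h₁ := unitRoot_mul_sub true y
    have h₂ : (w - unitRoot true y) * (w - unitRoot false y) = 0 := by
      have hs : unitRoot true y + unitRoot false y = y := by simp [unitRoot]; ring
      linear_combination h - h₁ - (w - unitRoot true y) * hs
    rcases mul_eq_zero.1 h₂ with h | h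
    · exact ⟨true, sub_eq_zero.1 h⟩
    · exact ⟨false, sub_eq_zero.1 h⟩
  · rintro ⟨b, rfl⟩
    exact unitRoot_mul_sub b y

theorem unitRoot_injective (y : ℝ) : Function.Injective fun b => unitRoot b y := by
  have h : 0 < Real.sqrt (y ^ 2 + 4) := Real.sqrt_pos.2 (by positivity)
  have hne : unitRoot true y ≠ unitRoot false y := by
    simp only [unitRoot, if_true, Bool.false_eq_true, if_false]
    intro h'
    linarith
  rintro (_ | _) (_ | _) hb
  · rfl
  · exact absurd hb.symm hne
  · exact absurd hb hne
  · rfl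

theorem contDiff_unitRoot (b : Bool) : ContDiff ℝ ∞ (unitRoot b) := by
  unfold unitRoot
  have : ContDiff ℝ ∞ fun y : ℝ => Real.sqrt (y ^ 2 + 4) :=
    ContDiff.sqrt (by fun_prop) fun y => by positivity
  fun_prop

/-- The sum `w + w⁻¹` for the two roots `w` of `w * (w - y) = 1`. -/
noncomputable def rootSum (b : Bool) (y : ℝ) : ℝ := 2 * unitRoot b y - y

theorem rootSum_sub_mul (b : Bool) (y : ℝ) : (rootSum b y - unitRoot b y) * unitRoot b y = 1 := by
  rw [rootSum]
  linear_combination unitRoot_mul_sub b y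

theorem rootSum_sq (b : Bool) (y : ℝ) : rootSum b y ^ 2 = y ^ 2 + 4 := by
  rw [rootSum]
  linear_combination 4 * unitRoot_mul_sub b y

theorem rootSum_ne_zero (b : Bool) (y : ℝ) : rootSum b y ≠ 0 := fun h => by
  have := rootSum_sq b y
  rw [h] at this
  nlinarith [sq_nonneg y]

theorem rootSum_sub_one_ne_zero (b : Bool) (y : ℝ) : rootSum b y - 1 ≠ 0 := fun h => by
  have := rootSum_sq b y
  rw [sub_eq_zero.1 h] at this
  nlinarith [sq_nonneg y]

theorem contDiff_rootSum (b : Bool) : ContDiff ℝ ∞ (rootSum b) := by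
  have := contDiff_unitRoot b
  unfold rootSum
  fun_prop

/-! ### Equality of the two null coordinates -/

namespace ProductEq

variable {I : Type}

/-- Seven equations that force the two null coordinates of the point `(i, 0)` to be equal to a number
`a`, which may be any real number. The other three points are `(w, w)`, `(p, p)` and
`((1 - p)⁻¹, p⁻¹)`, where `w` is a root of `w * (w - a) = 1` and `p = w + w⁻¹`. The last three
equations exclude the values `0` and `1` of `p`, which does no harm, because `p ^ 2 = a ^ 2 + 4`. -/
def transfer (i : I) : Set (ProductEq (I × Fin 4)) :=
  {⟨.var (i, 1), .const false, .var (i, 2), .var (i, 1), 1⟩,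
   ⟨.var (i, 2), .var (i, 1), .var (i, 1), .const false, 1⟩,
   ⟨.var (i, 1), .var (i, 0), .var (i, 1), .const false, 1⟩,
   ⟨.var (i, 1), .const false, .var (i, 1), .var (i, 0), 1⟩,
   ⟨.var (i, 2), .const false, .var (i, 3), .const false, 1⟩,
   ⟨.var (i, 3), .const true, .var (i, 3), .const true, 1⟩,
   ⟨.var (i, 3), .const false, .var (i, 2), .const true, -1⟩}

/-- The first null coordinates of a solution of the equations `transfer`. -/
noncomputable def transferU (ε : I → Bool) (x : I → ℝ) (j : I × Fin 4) : ℝ :=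
  ![x j.1, unitRoot (ε j.1) (x j.1), rootSum (ε j.1) (x j.1), -(rootSum (ε j.1) (x j.1) - 1)⁻¹] j.2

/-- The second null coordinates of a solution of the equations `transfer`. -/
noncomputable def transferV (ε : I → Bool) (x : I → ℝ) (j : I × Fin 4) : ℝ :=
  ![x j.1, unitRoot (ε j.1) (x j.1), rootSum (ε j.1) (x j.1), (rootSum (ε j.1) (x j.1))⁻¹] j.2

/-- The only freedom in a solution of the equations `transfer`, apart from the values `x`, is the
choice of one of two roots for each variable. -/
theorem transfer_iff (u v : I × Fin 4 → ℝ) :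
    (∀ i, ∀ κ ∈ transfer i, κ.Holds u v) ↔
      ∃ (ε : I → Bool) (x : I → ℝ), u = transferU ε x ∧ v = transferV ε x := by
  simp only [transfer, Set.mem_insert_iff, Set.mem_singleton_iff, forall_eq_or_imp, forall_eq,
    Holds, Entry.eval_var, Entry.eval_const, bit_false, bit_true, sub_zero]
  constructor
  · intro h
    have key : ∀ i, ∃ b, v (i, 0) = u (i, 0) ∧ u (i, 1) = unitRoot b (u (i, 0)) ∧
        v (i, 1) = unitRoot b (u (i, 0)) ∧ u (i, 2) = rootSum b (u (i, 0)) ∧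
        v (i, 2) = rootSum b (u (i, 0)) ∧ u (i, 3) = -(rootSum b (u (i, 0)) - 1)⁻¹ ∧
        v (i, 3) = (rootSum b (u (i, 0)))⁻¹ := by
      intro i
      obtain ⟨h₁, h₂, h₃, h₄, h₅, h₆, h₇⟩ := h i
      generalize u (i, 0) = a at *
      generalize v (i, 0) = a' at *
      generalize u (i, 1) = w at *
      generalize v (i, 1) = w' at *
      generalize u (i, 2) = p at *
      generalize v (i, 2) = p' at *
      generalize u (i, 3) = x at *
      generalize v (i, 3) = s at *
      have hp : p ≠ 0 := left_ne_zero_of_mul_eq_one h₅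
      -- The last three equations are a chain of homographies whose composite is the identity.
      have hpp : p' = p := by
        have hs : s - 1 ≠ 0 := right_ne_zero_of_mul_eq_one h₆
        have hx : x * (s - 1) = s := by linear_combination h₆
        have : (p' - p) * s = 0 := by
          linear_combination (s - 1) * h₇ - (p' - 1) * hx - h₅
        have hs' : s ≠ 0 := right_ne_zero_of_mul_eq_one h₅
        exact sub_eq_zero.1 ((mul_eq_zero.1 this).resolve_right hs')
      subst hpp
      have hww : w' = w := by
        have : p' * (w' - w) = 0 := by linear_combination h₂ - h₁
        exact sub_eq_zero.1 ((mul_eq_zero.1 this).resolve_left hp)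
      subst hww
      have hw : w' ≠ 0 := left_ne_zero_of_mul_eq_one h₁
      have ha : a' = a := mul_left_cancel₀ hw (by linear_combination h₃ - h₄)
      obtain ⟨b, rfl⟩ := (mul_sub_eq_one_iff w' a).1 (by linear_combination h₃)
      have hr : p' = rootSum b a :=
        mul_right_cancel₀ hw (by linear_combination h₂ - rootSum_sub_mul b a)
      subst hr
      refine ⟨b, ha, rfl, rfl, rfl, rfl, ?_, eq_inv_of_mul_eq_one_right h₅⟩
      exact neg_eq_iff_eq_neg.1 (eq_inv_of_mul_eq_one_left (by linear_combination -h₇))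
    choose ε hε using key
    refine ⟨ε, fun i => u (i, 0), funext fun ⟨i, k⟩ => ?_, funext fun ⟨i, k⟩ => ?_⟩
    · obtain ⟨_, h₁, _, h₂, _, h₃, _⟩ := hε i
      fin_cases k
      exacts [rfl, h₁, h₂, h₃]
    · obtain ⟨h₀, _, h₁, _, h₂, _, h₃⟩ := hε i
      fin_cases k
      exacts [h₀, h₁, h₂, h₃]
  · rintro ⟨ε, x, rfl, rfl⟩ i
    simp only [transferU, transferV, Matrix.cons_val]
    have h₀ := unitRoot_mul_sub (ε i) (x i)
    have h₁ := rootSum_sub_mul (ε i) (x i)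
    have h₂ := rootSum_ne_zero (ε i) (x i)
    have h₃ := rootSum_sub_one_ne_zero (ε i) (x i)
    refine ⟨?_, h₁, ?_, h₀, mul_inv_cancel₀ h₂, ?_, ?_⟩
    · linear_combination h₁
    · linear_combination h₀
    · field_simp
      ring
    · field_simp

/-- A system of product equations for the points `(i, 0)`, with equal null coordinates. -/
def diagonal (C : Set (ProductEq I)) : Set (ProductEq (I × Fin 4)) :=
  map (fun i => (i, 0)) '' C ∪ ⋃ i, transfer i

theorem finite_diagonal [Finite I] {C : Set (ProductEq I)} (hC : C.Finite) :
    (diagonal C).Finite := by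
  refine (hC.image _).union (Set.finite_iUnion fun i => ?_)
  unfold transfer
  exact Set.toFinite _

theorem diagonal_iff (C : Set (ProductEq I)) (u v : I × Fin 4 → ℝ) :
    (∀ κ ∈ diagonal C, κ.Holds u v) ↔ ∃ (ε : I → Bool) (x : I → ℝ),
      (∀ κ ∈ C, κ.Holds x x) ∧ u = transferU ε x ∧ v = transferV ε x := by
  have h : (∀ κ ∈ diagonal C, κ.Holds u v) ↔
      (∀ κ ∈ C, κ.Holds (fun i => u (i, 0)) fun i => v (i, 0)) ∧
        ∀ i, ∀ κ ∈ transfer i, κ.Holds u v := by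
    simp only [diagonal, Set.mem_union, or_imp, forall_and, Set.forall_mem_image, Set.mem_iUnion,
      forall_exists_index, holds_map]
    exact and_congr Iff.rfl forall_comm
  rw [h, transfer_iff]
  constructor
  · rintro ⟨hC, ε, x, rfl, rfl⟩
    exact ⟨ε, x, hC, rfl, rfl⟩
  · rintro ⟨ε, x, hC, rfl, rfl⟩
    exact ⟨hC, ε, x, rfl, rfl⟩

theorem transferU_injective {ε ε' : I → Bool} {x x' : I → ℝ}
    (h : transferU ε x = transferU ε' x') : ε = ε' ∧ x = x' := by
  have hx : x = x' := funext fun i => congrFun h (i, 0)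
  subst hx
  exact ⟨funext fun i => unitRoot_injective (x i) (congrFun h (i, 1)), rfl⟩

variable [Fintype I]

theorem contDiff_transferU (ε : I → Bool) (j : I × Fin 4) :
    ContDiff ℝ ∞ fun x : I → ℝ => transferU ε x j := by
  obtain ⟨i, k⟩ := j
  have hx := contDiff_apply ℝ ℝ (n := ∞) i
  have hp := (contDiff_rootSum (ε i)).comp hx
  fin_cases k
  · exact hx
  · exact (contDiff_unitRoot (ε i)).comp hx
  · exact hp
  · exact ((hp.sub contDiff_const).inv fun x => rootSum_sub_one_ne_zero _ _).neg

theorem contDiff_transferV (ε : I → Bool) (j : I × Fin 4) :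
    ContDiff ℝ ∞ fun x : I → ℝ => transferV ε x j := by
  obtain ⟨i, k⟩ := j
  have hx := contDiff_apply ℝ ℝ (n := ∞) i
  have hp := (contDiff_rootSum (ε i)).comp hx
  fin_cases k
  · exact hx
  · exact (contDiff_unitRoot (ε i)).comp hx
  · exact hp
  · exact hp.inv fun x => rootSum_ne_zero _ _

end ProductEq

/-! ### Systems with finitely many smooth sheets of solutions -/

/-- A finite system of product equations in finitely many real unknowns, whose solutions are
parametrized by `E × T` for a finite nonempty set `T`: over every `e : E` there are exactly the
pairwise different solutions `sheet t e`, and they depend smoothly on `e`. -/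
structure SheetedSystem (E : Type) [NormedAddCommGroup E] [NormedSpace ℝ E] where
  /-- the unknowns -/
  I : Type
  finite_I : Finite I
  /-- the equations -/
  eqs : Set (ProductEq I)
  finite_eqs : eqs.Finite
  /-- the labels of the sheets -/
  T : Type
  finite_T : Finite T
  nonempty_T : Nonempty T
  /-- the solutions -/
  sheet : T → E → I → ℝ
  contDiff_sheet : ∀ t i, ContDiff ℝ ∞ fun e => sheet t e i
  sheet_injective : ∀ e, Function.Injective fun t => sheet t e
  holds_iff : ∀ x, (∀ κ ∈ eqs, κ.Holds x x) ↔ ∃ t e, x = sheet t e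

namespace SheetedSystem

variable {E : Type} [NormedAddCommGroup E] [NormedSpace ℝ E]

/-- Some unknown of the system has the value `g e` in all solutions over `e`. -/
def Knows (M : SheetedSystem E) (g : E → ℝ) : Prop :=
  ∃ i, ∀ t e, M.sheet t e i = g e

theorem Knows.contDiff {M : SheetedSystem E} {g : E → ℝ} (h : M.Knows g) : ContDiff ℝ ∞ g := by
  obtain ⟨i, hi⟩ := h
  obtain ⟨t⟩ := M.nonempty_T
  simpa only [hi] using M.contDiff_sheet t i

/-- The relation `M ≤ M'` means that `M'` knows all the functions that `M` knows. -/
instance : Preorder (SheetedSystem E) where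
  le M M' := ∀ g, M.Knows g → M'.Knows g
  le_refl _ _ h := h
  le_trans _ _ _ h h' g hg := h' g (h g hg)

/-- The system without equations whose unknowns are the parameters. -/
def free (ν : Type) [Fintype ν] : SheetedSystem (ν → ℝ) where
  I := ν
  finite_I := inferInstance
  eqs := ∅
  finite_eqs := Set.finite_empty
  T := Unit
  finite_T := inferInstance
  nonempty_T := inferInstance
  sheet _ e := e
  contDiff_sheet _ i := contDiff_apply ℝ ℝ i
  sheet_injective _ := Function.injective_of_subsingleton _
  holds_iff x := by simp

/-- A system can be extended by new unknowns `J` and new equations `D`, if over every old solution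
`D` has a finite nonempty set of solutions that depends smoothly on the parameter, but not on the
sheet of the old solution. -/
theorem exists_extension (M : SheetedSystem E) {J T' : Type} [Finite J] [Finite T'] [Nonempty T']
    (D : Set (ProductEq (M.I ⊕ J))) (hD : D.Finite) (τ : T' → E → J → ℝ)
    (hτ : ∀ t j, ContDiff ℝ ∞ fun e => τ t e j) (hinj : ∀ e, Function.Injective fun t => τ t e)
    (hsol : ∀ t e y, (∀ κ ∈ D, κ.Holds (Sum.elim (M.sheet t e) y) (Sum.elim (M.sheet t e) y)) ↔
      ∃ t', y = τ t' e) :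
    ∃ M', M ≤ M' ∧ ∀ j g, (∀ t e, τ t e j = g e) → M'.Knows g := by
  have := M.finite_I
  have := M.finite_T
  have := M.nonempty_T
  let M' : SheetedSystem E :=
    { I := M.I ⊕ J
      finite_I := inferInstance
      eqs := ProductEq.map Sum.inl '' M.eqs ∪ D
      finite_eqs := (M.finite_eqs.image _).union hD
      T := M.T × T'
      finite_T := inferInstance
      nonempty_T := inferInstance
      sheet := fun t e => Sum.elim (M.sheet t.1 e) (τ t.2 e)
      contDiff_sheet := by
        rintro t (i | j)
        · exact M.contDiff_sheet t.1 i
        · exact hτ t.2 j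
      sheet_injective := by
        rintro e ⟨t, t'⟩ ⟨s, s'⟩ h
        obtain ⟨h₁, h₂⟩ := Sum.elim_eq_iff.1 h
        exact Prod.ext (M.sheet_injective e h₁) (hinj e h₂)
      holds_iff := by
        intro x
        have hx : x = Sum.elim (x ∘ Sum.inl) (x ∘ Sum.inr) := (Sum.elim_comp_inl_inr x).symm
        simp only [Set.mem_union, or_imp, forall_and, Set.forall_mem_image, ProductEq.holds_map]
        rw [M.holds_iff]
        constructor
        · rintro ⟨⟨t, e, h⟩, hd⟩
          rw [hx, h] at hd
          obtain ⟨t', h'⟩ := (hsol t e _).1 hd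
          exact ⟨(t, t'), e, by rw [hx, h, h']⟩
        · rintro ⟨⟨t, t'⟩, e, rfl⟩
          exact ⟨⟨t, e, rfl⟩, (hsol t e _).2 ⟨t', rfl⟩⟩ }
  refine ⟨M', ?_, ?_⟩
  · rintro g ⟨i, hi⟩
    exact ⟨Sum.inl i, fun t e => hi t.1 e⟩
  · intro j g h
    exact ⟨Sum.inr j, fun t e => h t.2 e⟩

theorem exists_knows_const (M : SheetedSystem E) (a : ℝ) :
    ∃ M', M ≤ M' ∧ M'.Knows fun _ => a := by
  obtain ⟨M', hle, h⟩ := M.exists_extension (J := Unit) (T' := Unit)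
    {⟨.var (Sum.inr ()), .const false, .const true, .const false, a⟩} (Set.finite_singleton _)
    (fun _ _ _ => a) (fun _ _ => contDiff_const) (fun _ => Function.injective_of_subsingleton _)
    (fun t e y => by
      simp only [Set.mem_singleton_iff, forall_eq, ProductEq.Holds, Entry.eval_var,
        Entry.eval_const, Sum.elim_inr, bit_false, bit_true, sub_zero, mul_one, exists_const]
      exact ⟨fun h => funext fun _ => h, fun h => congrFun h ()⟩)
  exact ⟨M', hle, h () _ fun _ _ => rfl⟩

/-- The value `g + a * h` is reached in two steps, since `h` is the difference of a root `w` of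
`w * (w - h) = 1` and its inverse, and for nonzero `w` products with `w` or `w⁻¹` are available. -/
theorem exists_knows_add_const_mul (M : SheetedSystem E) (a : ℝ) {g h : E → ℝ} (hg : M.Knows g)
    (hh : M.Knows h) : ∃ M', M ≤ M' ∧ M'.Knows fun e => g e + a * h e := by
  have cg := hg.contDiff
  have ch := hh.contDiff
  obtain ⟨i, hi⟩ := hg
  obtain ⟨k, hk⟩ := hh
  obtain ⟨M', hle, hM'⟩ := M.exists_extension (J := Fin 3) (T' := Bool)
    {⟨.var (Sum.inr 0), .const false, .var (Sum.inr 0), .var (Sum.inl k), 1⟩,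
     ⟨.var (Sum.inr 1), .var (Sum.inl i), .var (Sum.inr 0), .var (Sum.inl k), a⟩,
     ⟨.var (Sum.inr 2), .var (Sum.inr 1), .var (Sum.inr 0), .const false, -a⟩}
    (Set.toFinite _)
    (fun b e => ![unitRoot b (h e), g e + a * unitRoot b (h e), g e + a * h e])
    (fun b j => by
      have := (contDiff_unitRoot b).comp ch
      fin_cases j
      · exact this
      · exact cg.add (contDiff_const.mul this)
      · exact cg.add (contDiff_const.mul ch))
    (fun e b b' hb => unitRoot_injective (h e) (congrFun hb 0))
    (fun t e y => by
      simp only [Set.mem_insert_iff, Set.mem_singleton_iff, forall_eq_or_imp, forall_eq,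
        ProductEq.Holds, Entry.eval_var, Entry.eval_const, Sum.elim_inl, Sum.elim_inr, bit_false,
        sub_zero, hi, hk]
      rw [mul_sub_eq_one_iff]
      constructor
      · rintro ⟨⟨b, h₀⟩, h₁, h₂⟩
        have hw := unitRoot_mul_sub b (h e)
        have hw₀ := unitRoot_ne_zero b (h e)
        rw [h₀] at h₁ h₂
        have h₃ : y 1 = g e + a * unitRoot b (h e) := by
          refine mul_right_cancel₀ (right_ne_zero_of_mul_eq_one hw) ?_
          linear_combination h₁ - a * hw
        have h₄ : y 2 = g e + a * h e := by
          refine mul_right_cancel₀ hw₀ ?_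
          linear_combination h₂ + h₃ * unitRoot b (h e) + a * hw
        refine ⟨b, funext fun j => ?_⟩
        fin_cases j
        exacts [h₀, h₃, h₄]
      · rintro ⟨b, rfl⟩
        have hw := unitRoot_mul_sub b (h e)
        simp only [Matrix.cons_val]
        exact ⟨⟨b, rfl⟩, by linear_combination a * hw, by linear_combination -a * hw⟩)
  exact ⟨M', hle, hM' 2 _ fun _ _ => rfl⟩

/-- Squares are reached through partial fractions: with `p = w + w⁻¹` for a root `w` of
`w * (w - g) = 1`, one has `p ^ 2 = g ^ 2 + 4`, so `p` is different from `0` and `1`, and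
`(p - 1)⁻¹ - p⁻¹` is the inverse of `p ^ 2 - p`. -/
theorem exists_knows_sq (M : SheetedSystem E) {g : E → ℝ} (hg : M.Knows g) :
    ∃ M', M ≤ M' ∧ M'.Knows fun e => g e ^ 2 := by
  have cg := hg.contDiff
  obtain ⟨i, hi⟩ := hg
  obtain ⟨M', hle, hM'⟩ := M.exists_extension (J := Fin 7) (T' := Bool)
    {⟨.var (Sum.inr 0), .const false, .var (Sum.inr 0), .var (Sum.inl i), 1⟩,
     ⟨.var (Sum.inr 1), .var (Sum.inr 0), .var (Sum.inr 0), .const false, 1⟩,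
     ⟨.var (Sum.inr 1), .const false, .var (Sum.inr 2), .const false, 1⟩,
     ⟨.var (Sum.inr 1), .const true, .var (Sum.inr 3), .const false, 1⟩,
     ⟨.var (Sum.inr 3), .var (Sum.inr 2), .var (Sum.inr 4), .const false, 1⟩,
     ⟨.var (Sum.inr 5), .var (Sum.inr 4), .var (Sum.inr 2), .const false, 1⟩,
     ⟨.var (Sum.inr 6), .var (Sum.inr 5), .const true, .const false, -4⟩}
    (Set.toFinite _)
    (fun b e => ![unitRoot b (g e), rootSum b (g e), (rootSum b (g e))⁻¹,
      (rootSum b (g e) - 1)⁻¹, rootSum b (g e) * (rootSum b (g e) - 1), rootSum b (g e) ^ 2,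
      g e ^ 2])
    (fun b j => by
      have hw := (contDiff_unitRoot b).comp cg
      have hp := (contDiff_rootSum b).comp cg
      have hp1 := hp.sub (contDiff_const (c := (1 : ℝ)))
      fin_cases j
      · exact hw
      · exact hp
      · exact hp.inv fun e => rootSum_ne_zero b _
      · exact hp1.inv fun e => rootSum_sub_one_ne_zero b _
      · exact hp.mul hp1
      · exact hp.pow 2
      · exact cg.pow 2)
    (fun e b b' hb => unitRoot_injective (g e) (congrFun hb 0))
    (fun t e y => by
      simp only [Set.mem_insert_iff, Set.mem_singleton_iff, forall_eq_or_imp, forall_eq,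
        ProductEq.Holds, Entry.eval_var, Entry.eval_const, Sum.elim_inl, Sum.elim_inr, bit_false,
        bit_true, sub_zero, hi]
      rw [mul_sub_eq_one_iff]
      constructor
      · rintro ⟨⟨b, h₀⟩, h₁, h₂, h₃, h₄, h₅, h₆⟩
        have hp := rootSum_ne_zero b (g e)
        have hp1 := rootSum_sub_one_ne_zero b (g e)
        rw [h₀] at h₁
        have k₁ : y 1 = rootSum b (g e) := by
          refine mul_right_cancel₀ (unitRoot_ne_zero b (g e)) ?_
          linear_combination h₁ - rootSum_sub_mul b (g e)
        rw [k₁] at h₂ h₃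
        have k₂ := eq_inv_of_mul_eq_one_right h₂
        have k₃ := eq_inv_of_mul_eq_one_right h₃
        have k₄ : y 4 = rootSum b (g e) * (rootSum b (g e) - 1) := by
          rw [k₂, k₃] at h₄
          field_simp at h₄
          linear_combination h₄
        have k₅ : y 5 = rootSum b (g e) ^ 2 := by
          rw [k₂, k₄] at h₅
          field_simp at h₅
          linear_combination h₅
        have k₆ : y 6 = g e ^ 2 := by
          linear_combination h₆ + k₅ + rootSum_sq b (g e)
        refine ⟨b, funext fun j => ?_⟩
        fin_cases j
        exacts [h₀, k₁, k₂, k₃, k₄, k₅, k₆]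
      · rintro ⟨b, rfl⟩
        have hp := rootSum_ne_zero b (g e)
        have hp1 := rootSum_sub_one_ne_zero b (g e)
        simp only [Matrix.cons_val]
        refine ⟨⟨b, rfl⟩, rootSum_sub_mul b _, mul_inv_cancel₀ hp, mul_inv_cancel₀ hp1, ?_, ?_, ?_⟩
        · field_simp
          ring
        · field_simp
          ring
        · linear_combination -rootSum_sq b (g e))
  exact ⟨M', hle, hM' 6 _ fun _ _ => rfl⟩

/-! ### Polynomials -/

/-- Every system that knows all the functions known to `M₀` can be extended to one that, in addition,
knows `g`. -/
def Attainable (g : E → ℝ) (M₀ : SheetedSystem E) : Prop :=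
  ∀ M, M₀ ≤ M → ∃ M', M ≤ M' ∧ M'.Knows g

section Attainable

variable {M₀ : SheetedSystem E} {g h : E → ℝ}

theorem Attainable.add_const_mul (hg : Attainable g M₀) (a : ℝ) (hh : Attainable h M₀) :
    Attainable (fun e => g e + a * h e) M₀ := by
  intro M hM
  obtain ⟨M₁, h₁, k₁⟩ := hg M hM
  obtain ⟨M₂, h₂, k₂⟩ := hh M₁ (hM.trans h₁)
  obtain ⟨M₃, h₃, k₃⟩ := M₂.exists_knows_add_const_mul a (h₂ _ k₁) k₂
  exact ⟨M₃, h₁.trans (h₂.trans h₃), k₃⟩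

theorem Attainable.sq (hg : Attainable g M₀) : Attainable (fun e => g e ^ 2) M₀ := by
  intro M hM
  obtain ⟨M₁, h₁, k₁⟩ := hg M hM
  obtain ⟨M₂, h₂, k₂⟩ := M₁.exists_knows_sq k₁
  exact ⟨M₂, h₁.trans h₂, k₂⟩

theorem attainable_const (M₀ : SheetedSystem E) (a : ℝ) : Attainable (fun _ => a) M₀ :=
  fun M _ => M.exists_knows_const a

theorem Attainable.mul (hg : Attainable g M₀) (hh : Attainable h M₀) :
    Attainable (fun e => g e * h e) M₀ := by
  have h₁ := (hg.add_const_mul 1 hh).sq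
  have h₂ := (hg.add_const_mul (-1) hh).sq
  have h₃ := (((attainable_const M₀ 0).add_const_mul (1 / 4) h₁).add_const_mul (-1 / 4) h₂)
  refine (funext fun e => ?_ : (fun e => g e * h e) = _) ▸ h₃
  ring

theorem attainable_eval {ν : Type} [Fintype ν] (f : MvPolynomial ν ℝ) :
    Attainable (fun e => MvPolynomial.eval e f) (free ν) := by
  induction f using MvPolynomial.induction_on with
  | C a => simpa using attainable_const (free ν) a
  | add p q hp hq => simpa using hp.add_const_mul 1 hq
  | mul_X p i hp =>
    have hX : Attainable (fun e : ν → ℝ => e i) (free ν) := fun M hM =>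
      ⟨M, le_rfl, hM _ ⟨i, fun _ _ => rfl⟩⟩
    simpa using hp.mul hX

end Attainable

/-- Finitely many polynomials are known to a common system. -/
theorem exists_knows_eval {ν κ : Type} [Fintype ν] [Finite κ] (f : κ → MvPolynomial ν ℝ) :
    ∃ M : SheetedSystem (ν → ℝ), ∀ k, M.Knows fun e => MvPolynomial.eval e (f k) := by
  suffices h : ∀ s : Set κ, ∃ M, free ν ≤ M ∧ ∀ k ∈ s, M.Knows fun e => MvPolynomial.eval e (f k) by
    obtain ⟨M, _, hM⟩ := h Set.univ
    exact ⟨M, fun k => hM k (Set.mem_univ k)⟩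
  intro s
  induction s, s.toFinite using Set.Finite.induction_on with
  | empty => exact ⟨free ν, le_rfl, by simp⟩
  | insert _ _ ih =>
    obtain ⟨M, hM, hk⟩ := ih
    obtain ⟨M', hM', hk'⟩ := attainable_eval (f _) M hM
    exact ⟨M', hM.trans hM', Set.forall_mem_insert.2 ⟨hk', fun k h => hM' _ (hk k h)⟩⟩

end SheetedSystem

/-! ### Coverings -/

/-- Finitely many pairwise disjoint smooth sections of a smooth map, defined on the whole base,
make their images over `A` a trivial covering of `A`. -/
theorem isSmoothFiniteTrivialCovering_of_sections {E F : Type} [NormedAddCommGroup E]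
    [NormedSpace ℝ E] [NormedAddCommGroup F] [NormedSpace ℝ F] {ρ : E → F} {S : Set E} {A : Set F}
    (hρ : ContDiff ℝ ∞ ρ) {T : Type} [Finite T] [Nonempty T] (σ : T → F → E)
    (hσ : ∀ t, ContDiff ℝ ∞ (σ t)) (hsec : ∀ t a, ρ (σ t a) = a)
    (hinj : ∀ a, Function.Injective fun t => σ t a) (hS : S = {x | ∃ t, ∃ a ∈ A, x = σ t a}) :
    IsSmoothFiniteTrivialCovering ρ S A := by
  obtain ⟨k, ⟨e⟩⟩ := Finite.exists_equiv_fin T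
  have hk : 0 < k := Fin.pos_iff_nonempty.2 (e.nonempty_congr.1 inferInstance)
  refine ⟨⟨ρ, hρ, fun _ _ => rfl⟩, k, hk, ?_⟩
  have hex : ∀ x : S, ∃ j : Fin k, (x : E) = σ (e.symm j) (ρ x) := by
    rintro ⟨x, hx⟩
    obtain ⟨t, a, _, rfl⟩ := hS ▸ hx
    exact ⟨e t, by simp only [Equiv.symm_apply_apply, hsec]⟩
  choose J hJ using hex
  have hJ' : ∀ (x : S) j, (x : E) = σ (e.symm j) (ρ x) → J x = j := fun x j h =>
    e.symm.injective (hinj (ρ x) ((hJ x).symm.trans h))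
  have hA : ∀ x : S, ρ x ∈ A := by
    rintro ⟨x, hx⟩
    obtain ⟨t, a, ha, rfl⟩ := hS ▸ hx
    simpa only [hsec] using ha
  have hmem : ∀ (a : A) (j : Fin k), σ (e.symm j) a ∈ S := fun a j => by
    rw [hS]
    exact ⟨_, a, a.2, rfl⟩
  -- The sheets are closed and finite in number, so the labels of the sheets depend continuously
  -- on the point.
  have hcont : Continuous J := by
    refine continuous_iff_isClosed.2 fun s _ => ?_
    have hs : J ⁻¹' s = ⋃ j ∈ s, {x : S | (x : E) = σ (e.symm j) (ρ x)} := by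
      ext x
      simp only [Set.mem_preimage, Set.mem_iUnion, Set.mem_ofPred_eq, exists_prop]
      exact ⟨fun h => ⟨J x, h, hJ x⟩, fun ⟨j, hj, h⟩ => hJ' x j h ▸ hj⟩
    rw [hs]
    refine s.toFinite.isClosed_biUnion fun j _ => isClosed_eq continuous_subtype_val ?_
    exact (hσ _).continuous.comp (hρ.continuous.comp continuous_subtype_val)
  let Φ : S ≃ₜ A × Fin k :=
    { toFun := fun x => (⟨ρ x, hA x⟩, J x)
      invFun := fun p => ⟨σ (e.symm p.2) p.1, hmem p.1 p.2⟩
      left_inv := fun x => Subtype.ext (hJ x).symm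
      right_inv := fun p => by
        refine Prod.ext (Subtype.ext (hsec _ _)) (hJ' _ _ ?_)
        simp only [hsec]
      continuous_toFun :=
        ((hρ.continuous.comp continuous_subtype_val).subtype_mk _).prodMk hcont
      continuous_invFun := by
        refine Continuous.subtype_mk ?_ _
        refine continuous_prod_of_discrete_right.2 fun j => ?_
        exact (hσ (e.symm j)).continuous.comp continuous_subtype_val }
  exact ⟨Φ, fun _ => rfl, fun j => ⟨σ (e.symm j), ⟨_, hσ _, fun _ _ => rfl⟩, fun _ => rfl⟩⟩

/-! ### Linkages for algebraic sets -/

/-- An algebraic set in any number of real variables, some pairs of which are the coordinates of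
`n` points, is the set of parameters of the realizations of a linkage with `n` marked vertices at
these points. -/
theorem exists_linkage_of_isAlgebraicSet {ν : Type} [Fintype ν] {n : ℕ} (c : Fin n × Fin 2 → ν)
    {B : Set (ν → ℝ)} (hB : IsAlgebraicSet B) :
    ∃ (V : Type) (_ : Fintype V) (L : Linkage V) (P : Fin n → V) (T : Type) (_ : Finite T)
      (_ : Nonempty T) (σ : T → (ν → ℝ) → V → MinkowskiPlane),
      Function.Injective P ∧ L.graph.Connected ∧ L.fixed.Nonempty ∧
      (∀ t, ContDiff ℝ ∞ (σ t)) ∧ (∀ b, Function.Injective fun t => σ t b) ∧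
      (∀ t b j, σ t b (P j) = (b (c (j, 0)), b (c (j, 1)))) ∧
      L.conf = {φ | ∃ t, ∃ b ∈ B, φ = σ t b} := by
  obtain ⟨m, f, rfl⟩ := hB
  obtain ⟨M, hM⟩ := SheetedSystem.exists_knows_eval (ν := ν) (κ := Fin m ⊕ Fin n ⊕ Fin n)
    (Sum.elim f (Sum.elim
      (fun j => MvPolynomial.X (c (j, 0)) - MvPolynomial.X (c (j, 1)))
      (fun j => MvPolynomial.X (c (j, 0)) + MvPolynomial.X (c (j, 1)))))
  choose z hz using fun j => hM (Sum.inl j)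
  choose u hu using fun j => hM (Sum.inr (Sum.inl j))
  choose v hv using fun j => hM (Sum.inr (Sum.inr j))
  simp only [Sum.elim_inl, Sum.elim_inr, map_sub, map_add, MvPolynomial.eval_X] at hz hu hv
  have := M.finite_I
  let := Fintype.ofFinite M.I
  have := M.finite_T
  have := M.nonempty_T
  let zeros : Set (ProductEq M.I) :=
    Set.range fun j => ⟨.var (z j), .const false, .const true, .const false, 0⟩
  let D : Set (ProductEq (M.I × Fin 4)) := ProductEq.diagonal (M.eqs ∪ zeros)
  have hD : D.Finite := ProductEq.finite_diagonal (M.finite_eqs.union (Set.finite_range _))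
  have := hD.to_subtype
  let κ : D → ProductEq (M.I × Fin 4) := Subtype.val
  let mk : Fin n → Entry (M.I × Fin 4) × Entry (M.I × Fin 4) := fun j =>
    (.var (u j, 0), .var (v j, 0))
  let σ : M.T × (M.I → Bool) → (ν → ℝ) → Vertex (M.I × Fin 4) ((D × Bool) ⊕ Fin n) →
      MinkowskiPlane := fun t b =>
    Vertex.place (ProductEq.points κ mk) (ProductEq.transferU t.2 (M.sheet t.1 b))
      (ProductEq.transferV t.2 (M.sheet t.1 b))
  let hV : Fintype (Vertex (M.I × Fin 4) ((D × Bool) ⊕ Fin n)) := Fintype.ofFinite _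
  refine ⟨Vertex (M.I × Fin 4) ((D × Bool) ⊕ Fin n), hV, ProductEq.linkage κ mk,
    fun j => .point (Sum.inr j), M.T × (M.I → Bool), inferInstance, inferInstance, σ, ?_,
    ProductEq.connected_linkage κ mk, ProductEq.fixed_linkage_nonempty κ mk, ?_, ?_, ?_, ?_⟩
  · intro j j' h
    simpa using h
  · intro t
    have hU : ∀ i, ContDiff ℝ ∞ fun b => ProductEq.transferU t.2 (M.sheet t.1 b) i :=
      fun i => (ProductEq.contDiff_transferU t.2 i).comp (contDiff_pi.2 (M.contDiff_sheet t.1))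
    have hV : ∀ i, ContDiff ℝ ∞ fun b => ProductEq.transferV t.2 (M.sheet t.1 b) i :=
      fun i => (ProductEq.contDiff_transferV t.2 i).comp (contDiff_pi.2 (M.contDiff_sheet t.1))
    exact Vertex.contDiff_place _ hU hV
  · rintro b ⟨t, ε⟩ ⟨t', ε'⟩ h
    obtain ⟨h, _⟩ := Vertex.place_injective _ h
    obtain ⟨h₁, h₂⟩ := ProductEq.transferU_injective h
    exact Prod.ext (M.sheet_injective b h₂) h₁
  · intro t b j
    change nullPoint (M.sheet t.1 b (u j)) (M.sheet t.1 b (v j)) = _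
    rw [hu, hv, nullPoint]
    ext <;> simp only <;> ring
  · ext φ
    rw [ProductEq.mem_conf_linkage]
    have hzeros : ∀ x, (∀ κ ∈ zeros, κ.Holds x x) ↔ ∀ j, x (z j) = 0 := fun x => by
      simp [zeros, ProductEq.Holds]
    have hκ : ∀ U W, (∀ k, (κ k).Holds U W) ↔ ∀ k ∈ D, k.Holds U W := fun U W => Subtype.forall
    simp only [hκ, D, ProductEq.diagonal_iff, Set.mem_union, or_imp, forall_and, hzeros,
      M.holds_iff]
    constructor
    · rintro ⟨_, _, ⟨ε, _, ⟨⟨t, b, rfl⟩, h₀⟩, rfl, rfl⟩, rfl⟩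
      exact ⟨(t, ε), b, fun j => (hz j t b).symm.trans (h₀ j), rfl⟩
    · rintro ⟨⟨t, ε⟩, b, hb, rfl⟩
      exact ⟨_, _, ⟨ε, _, ⟨⟨t, b, rfl⟩, fun j => (hz j t b).trans (hb j)⟩, rfl, rfl⟩, rfl⟩

theorem theorem1p4 (n : ℕ) (A : Set (Fin n → MinkowskiPlane)) (hA : IsSemialgebraicSubset A) :
    (∃ (V : Type) (_ : Fintype V) (L : Linkage V) (W : Set V) (e : Fin n ≃ W),
      L.graph.Connected ∧ L.fixed.Nonempty ∧
      relabel e '' L.partialConf W = A) ∧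
    (IsAlgebraicSubset A →
      ∃ (V : Type) (_ : Fintype V) (L : Linkage V) (W : Set V) (e : Fin n ≃ W),
        L.graph.Connected ∧ L.fixed.Nonempty ∧
        relabel e '' L.partialConf W = A ∧
        IsSmoothFiniteTrivialCovering
          (fun φ : V → MinkowskiPlane => relabel e (W.domRestrict φ)) L.conf A) := by
  constructor
  · obtain ⟨k, B, hB, hAB⟩ := hA
    obtain ⟨V, hV, L, P, T, _, ⟨t₀⟩, σ, hP, hcon, hfix, -, -, hσP, hL⟩ :=
      exists_linkage_of_isAlgebraicSet (Sum.inl : Fin n × Fin 2 → _) hB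
    have hpt : ∀ t b, relabel (Equiv.ofInjective P hP) ((Set.range P).domRestrict (σ t b)) =
        (minkowskiCoords n).symm fun i => b (Sum.inl i) :=
      fun t b => funext fun j => hσP t b j
    refine ⟨V, hV, L, Set.range P, Equiv.ofInjective P hP, hcon, hfix, ?_⟩
    rw [Linkage.partialConf, Set.image_image, hL]
    ext a
    rw [← (minkowskiCoords n).injective.mem_set_image (s := A), hAB]
    constructor
    · rintro ⟨_, ⟨t, b, hb, rfl⟩, rfl⟩
      exact ⟨b, hb, by simp only [hpt, Equiv.apply_symm_apply]⟩
    · rintro ⟨b, hb, h⟩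
      exact ⟨_, ⟨t₀, b, hb, rfl⟩, (hpt t₀ b).trans ((Equiv.symm_apply_eq _).2 h)⟩
  · intro hA
    obtain ⟨V, hV, L, P, T, _, _, σ, hP, hcon, hfix, hσ, hinj, hσP, hL⟩ :=
      exists_linkage_of_isAlgebraicSet id hA
    have hsec : ∀ t a, relabel (Equiv.ofInjective P hP)
        ((Set.range P).domRestrict (σ t (minkowskiCoords n a))) = a :=
      fun t a => funext fun j => hσP t _ j
    have hconf : L.conf = {φ | ∃ t, ∃ a ∈ A, φ = σ t (minkowskiCoords n a)} := by
      simp only [hL, Set.exists_mem_image]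
    refine ⟨V, hV, L, Set.range P, Equiv.ofInjective P hP, hcon, hfix, ?_, ?_⟩
    · rw [Linkage.partialConf, Set.image_image, hconf]
      ext a
      constructor
      · rintro ⟨_, ⟨t, a, ha, rfl⟩, rfl⟩
        simpa only [hsec] using ha
      · intro ha
        exact ⟨_, ⟨Classical.arbitrary T, a, ha, rfl⟩, hsec _ _⟩
    · refine isSmoothFiniteTrivialCovering_of_sections ?_ (fun t a => σ t (minkowskiCoords n a))
        ?_ hsec (fun a => hinj _) hconf
      · exact contDiff_pi.2 fun j => contDiff_apply ℝ MinkowskiPlane (P j)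
      · intro t
        refine (hσ t).comp (contDiff_pi.2 fun ij => ?_)
        have h := contDiff_apply ℝ MinkowskiPlane (n := ∞) ij.1
        by_cases hij : ij.2 = 0
        · simpa [minkowskiCoords, hij] using h.fst
        · simpa [minkowskiCoords, hij] using h.snd
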